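/- Let $G=(V,E)$ be a finite simple graph with edge weights $w:E\to\mathbb{R}_{\ge 0}$, and let $p\in(0,1]$. Each edge of $G$ is realized independently with probability $p$; let $E_p\subseteq E$ be the random set of realized edges. For $F\subseteq E$ let $M(F)$ be a maximum weight matching of $(V,F)$, found by a fixed deterministic rule (ties are broken arbitrarily), and let $w(M(F))$ be its weight. Put $\mathrm{OPT}=\mathbb{E}[w(M(E_p))]$. For $\epsilon\in(0,1)$ consider the following non-adaptive algorithm. Let $$R=\left\lceil\frac{2000\,\log(1/\epsilon)\,\log(1/(\epsilon p))}{\epsilon^4 p}\right\rceil .$$ Draw independent random subsets $\mathcal{E}_1,\dots,\mathcal{E}_R$ of $E$, independent of $E_p$ and each with the same distribution as $E_p$; query all the edges of $S=\bigcup_{r=1}^R M(\mathcal{E}_r)$; and report $M(S\cap E_p)$. Then for every sufficiently small $\epsilon>0$ the algorithm is, in expectation, a $(1/2-\epsilon)$-approximation and queries $\tilde{O}(1/(\epsilon^4p))$ edges per vertex. Precisely, there are absolute constants $\epsilon_0>0$, $C$ and $k\in\mathbb{N}$ such that for every $0<\epsilon\le\epsilon_0$, every $p\in(0,1]$, every finite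 weighted graph $G$ and every choice of the rule $M$: 1. for every outcome of $\mathcal{E}_1,\dots,\mathcal{E}_R$, every vertex of $G$ is incident to at most $C\cdot\frac{1}{\epsilon^4p}\cdot\log^k\!\left(\frac{1}{\epsilon^4p}\right)$ edges of $S$; 2. $\mathbb{E}\big[w(M(S\cap E_p))\big]\ \ge\ \left(\tfrac12-\epsilon\right)\mathrm{OPT}$, where the expectation is over $\mathcal{E}_1,\dots,\mathcal{E}_R$ and $E_p$. -/

import Mathlib

open MeasureTheory ProbabilityTheory

noncomputable section

namespace StochasticMatching

variable {V : Type*}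

/-- `M` is a matching all of whose edges lie in `F`: distinct edges of `M` share no vertex. -/
def IsMatchingIn (F : Set (Sym2 V)) (M : Finset (Sym2 V)) : Prop :=
  (M : Set (Sym2 V)) ⊆ F ∧ ∀ e ∈ M, ∀ f ∈ M, ∀ v : V, v ∈ e → v ∈ f → e = f

/-- The total weight of a finite set of edges. -/
def weight (w : Sym2 V → ℝ) (M : Finset (Sym2 V)) : ℝ := ∑ e ∈ M, w e

/-- `M` is a maximum weight matching in the edge set `F`. -/
def IsMaxMatchingIn (w : Sym2 V → ℝ) (F : Set (Sym2 V)) (M : Finset (Sym2 V)) : Prop :=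
  IsMatchingIn F M ∧ ∀ M' : Finset (Sym2 V), IsMatchingIn F M' → weight w M' ≤ weight w M

/-- The weight of a maximum weight matching in the edge set `F`. -/
def maxMatchingWeight (w : Sym2 V → ℝ) (F : Set (Sym2 V)) : ℝ :=
  sSup {x : ℝ | ∃ M : Finset (Sym2 V), IsMatchingIn F M ∧ weight w M = x}

/-- The law of the random realized edge set of `G`: every edge of `G` is realized
independently with probability `p`. -/
def realizationLaw (G : SimpleGraph V) (p : unitInterval) : Measure (Set (Sym2 V)) :=
  setBernoulli G.edgeSet p

/-- The expected weight of a maximum weight realized matching in the edge set `H`. -/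
def expectedMatching (G : SimpleGraph V) (w : Sym2 V → ℝ) (p : unitInterval)
    (H : Set (Sym2 V)) : ℝ :=
  ∫ F, maxMatchingWeight w (H ∩ F) ∂(realizationLaw G p)

/-- The omniscient optimum: the expected weight of a maximum weight matching of the realized
graph. -/
def opt (G : SimpleGraph V) (w : Sym2 V → ℝ) (p : unitInterval) : ℝ :=
  expectedMatching G w p G.edgeSet

/-- `sel` is a deterministic maximum weight matching algorithm for subgraphs of `G`. -/
def IsMatchingRule (G : SimpleGraph V) (w : Sym2 V → ℝ)
    (sel : Set (Sym2 V) → Finset (Sym2 V)) : Prop :=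
  ∀ F : Set (Sym2 V), F ⊆ G.edgeSet → IsMaxMatchingIn w F (sel F)

/-- The number of rounds of the algorithm. -/
def rounds (ε p : ℝ) : ℕ :=
  ⌈2000 * Real.log (1 / ε) * Real.log (1 / (ε * p)) / (ε ^ 4 * p)⌉₊

/-- The law of the simulated realizations: `R` independent realizations of `G`. -/
def roundsLaw (G : SimpleGraph V) (p : unitInterval) (R : ℕ) :
    Measure (Fin R → Set (Sym2 V)) :=
  Measure.pi fun _ : Fin R => realizationLaw G p

/-- The set of edges queried by the algorithm when the simulated realizations are `𝓔`: the union
of the maximum weight matchings of the simulated realizations. -/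
def queried {R : ℕ} (sel : Set (Sym2 V) → Finset (Sym2 V)) (𝓔 : Fin R → Set (Sym2 V)) :
    Set (Sym2 V) :=
  ⋃ r : Fin R, (sel (𝓔 r) : Set (Sym2 V))

/-- The number of edges of `S` that are incident to the vertex `v`. -/
def degreeIn (S : Set (Sym2 V)) (v : V) : ℕ := {e ∈ S | v ∈ e}.ncard

/-- The matching reported by the algorithm when the simulated realizations are `𝓔` and the actual
realized edge set is `F`: a maximum weight matching of the queried edges that are realized. -/
def reported {R : ℕ} (sel : Set (Sym2 V) → Finset (Sym2 V)) (𝓔 : Fin R → Set (Sym2 V))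
    (F : Set (Sym2 V)) : Finset (Sym2 V) :=
  sel (queried sel 𝓔 ∩ F)

/-- The expected weight of the matching reported by the algorithm with `R` rounds, over the
simulated realizations and the actual realization, which are all independent. -/
def expectedReported (G : SimpleGraph V) (w : Sym2 V → ℝ) (p : unitInterval) (R : ℕ)
    (sel : Set (Sym2 V) → Finset (Sym2 V)) : ℝ :=
  ∫ 𝓔, (∫ F, weight w (reported sel 𝓔 F) ∂(realizationLaw G p)) ∂(roundsLaw G p R)

end StochasticMatching

end

/-! Let `q e` be the probability that `e` lies in the maximum matching of a random realization, so
that OPT is the sum of `w e * q e`. Split this sum at a threshold `τ`. Each half is recovered by the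
algorithm up to a factor `1 - 2ε`. The expected reported weight is thus at least the average of the
two recovered amounts, which gives `1/2 - ε` (`le_expectedReported`).

Edges with `q e ≥ τ` (`sum_crucial_le`): in `R` rounds such an edge is almost surely queried. In the
matching of the actual realization, keep only the queried edges of this kind. The rounds are
independent of the realization, so `e` survives with probability close to `q e`.

Edges with `q e < τ` (`sum_noncrucial_le`): the frequencies with which edges are selected over the
rounds form a fractional matching on the queried edges. Setting frequencies above `θ` to zero loses
little, by a second moment bound (`le_integral_truncatedFreq`). A fractional matching with such
small values is nearly attained by realized matchings (`sum_le_integral_of_fractional`). Keep the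
realized edges that cross a uniform random cut, each surviving with probability `p/2`, and scale up
by about `2/p`. Small values make vertex loads concentrate, so deleting overloaded vertices costs
little. What remains is a bipartite fractional matching, and Birkhoff's theorem rounds it without
loss (`exists_matching_of_bipartite`). The cut removes the odd-set constraints, and its factor `1/2`
is regained by the scaling. -/

namespace StochasticMatching

open scoped Classical

/-! ### Integrality of bipartite fractional matchings -/

/-- A substochastic matrix is dominated, with respect to any weights, by a permutation of the
doubled index set. -/
lemma exists_perm_sum_le {V : Type*} [Fintype V] (a W : V → V → ℝ) (ha : ∀ u v, 0 ≤ a u v)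
    (hrow : ∀ u, ∑ v, a u v ≤ 1) (hcol : ∀ v, ∑ u, a u v ≤ 1) :
    ∃ σ : Equiv.Perm (V ⊕ V), ∑ u, ∑ v, a u v * W u v ≤
      ∑ u, ∑ v, if σ (Sum.inl u) = Sum.inl v then W u v else 0 := by
  -- The diagonal blocks hold the row and column slacks, and the transposed copy of `a` completes
  -- the sums to `1`, so Birkhoff's theorem applies.
  let D : Matrix (V ⊕ V) (V ⊕ V) ℝ := Matrix.fromBlocks (Matrix.of a)
    (Matrix.diagonal fun u => 1 - ∑ v, a u v) (Matrix.diagonal fun v => 1 - ∑ u, a u v)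
    (Matrix.of a).transpose
  have hD : D ∈ doublyStochastic ℝ (V ⊕ V) := by
    rw [mem_doublyStochastic_iff_sum]
    refine ⟨?_, ?_, ?_⟩
    · rintro (i | i) (j | j)
      · exact ha i j
      · simp only [D, Matrix.fromBlocks_apply₁₂, Matrix.diagonal_apply]
        split_ifs
        · linarith [hrow i]
        · exact le_rfl
      · simp only [D, Matrix.fromBlocks_apply₂₁, Matrix.diagonal_apply]
        split_ifs
        · linarith [hcol i]
        · exact le_rfl
      · exact ha j i
    · rintro (i | i) <;> simp [D, Matrix.diagonal_apply]
    · rintro (i | i) <;> simp [D, Matrix.diagonal_apply]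
  obtain ⟨c, hc0, hc1, hcD⟩ := exists_eq_sum_perm_of_mem_doublyStochastic hD
  -- The value of `a` is a convex combination of the values of the permutations, so they cannot all
  -- be smaller.
  by_contra! hlt
  have key : ∑ u, ∑ v, a u v * W u v =
      ∑ σ, c σ * ∑ u, ∑ v, if σ (Sum.inl u) = Sum.inl v then W u v else 0 := by
    have h (u v : V) : a u v = ∑ σ, c σ * if σ (Sum.inl u) = Sum.inl v then 1 else 0 := by
      have := congrFun (congrFun hcD (Sum.inl u)) (Sum.inl v)
      simpa [D, Matrix.sum_apply, Equiv.Perm.permMatrix, PEquiv.toMatrix_apply, eq_comm]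
        using this.symm
    simp_rw [h, Finset.mul_sum, Finset.sum_mul]
    conv_rhs => rw [Finset.sum_comm]
    refine Finset.sum_congr rfl fun u _ => ?_
    conv_rhs => rw [Finset.sum_comm]
    refine Finset.sum_congr rfl fun v _ => Finset.sum_congr rfl fun σ _ => ?_
    split_ifs <;> simp
  have : ∑ σ, c σ * (∑ u, ∑ v, if σ (Sum.inl u) = Sum.inl v then W u v else 0) <
      ∑ σ, c σ * ∑ u, ∑ v, a u v * W u v := by
    refine Finset.sum_lt_sum (fun σ _ => mul_le_mul_of_nonneg_left (hlt σ).le (hc0 σ)) ?_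
    by_contra! h
    have h0 : ∀ σ, c σ = 0 := fun σ => by
      by_contra hne
      have := h σ (Finset.mem_univ _)
      exact absurd (le_of_mul_le_mul_left this ((hc0 σ).lt_of_ne' hne)) (hlt σ).not_ge
    simp [h0] at hc1
  rw [← Finset.sum_mul, hc1, one_mul, ← key] at this
  exact lt_irrefl _ this

/-- A fractional matching supported on a bipartite edge set is dominated by a matching. -/
lemma exists_matching_of_bipartite {V : Type*} [Fintype V] (K : Finset (Sym2 V)) (A : Set V)
    (x w : Sym2 V → ℝ) (hx : ∀ e, 0 ≤ x e)
    (hcross : ∀ u v, s(u, v) ∈ K → (u ∈ A ↔ v ∉ A))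
    (hdeg : ∀ u, ∑ v, (if s(u, v) ∈ K then x s(u, v) else 0) ≤ 1) :
    ∃ M : Finset (Sym2 V), IsMatchingIn (K : Set (Sym2 V)) M ∧
      ∑ e ∈ K, x e * w e ≤ weight w M := by
  -- Rows are restricted to `A`: each edge of `K` is counted once, directed from `A` to its
  -- complement.
  let a : V → V → ℝ := fun u v => if u ∈ A ∧ s(u, v) ∈ K then x s(u, v) else 0
  let W : V → V → ℝ := fun u v => if u ∈ A ∧ s(u, v) ∈ K then w s(u, v) else 0
  have ha : ∀ u v, 0 ≤ a u v := fun u v => by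
    simp only [a]; split_ifs <;> simp [hx]
  have hle : ∀ u v, a u v ≤ if s(u, v) ∈ K then x s(u, v) else 0 := fun u v => by
    simp only [a]
    have := hx s(u, v)
    split_ifs <;> simp_all
  obtain ⟨σ, hσ⟩ := exists_perm_sum_le a W ha
    (fun u => (Finset.sum_le_sum fun v _ => hle u v).trans (hdeg u))
    (fun v => (Finset.sum_le_sum fun u _ => hle u v).trans (by
      simpa only [Sym2.eq_swap] using hdeg v))
  let P : Finset (V × V) := Finset.univ.filter fun q => q.1 ∈ A ∧ s(q.1, q.2) ∈ K
  have hinj : Set.InjOn (fun q : V × V => s(q.1, q.2)) P := by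
    rintro ⟨u, v⟩ h ⟨u', v'⟩ h' heq
    simp only [P, Finset.coe_filter, Finset.mem_univ, true_and, Set.mem_ofPred_eq] at h h'
    have h1 := hcross u v h.2
    have h2 := hcross u' v' h'.2
    simp only [Sym2.eq_iff] at heq
    rcases heq with ⟨rfl, rfl⟩ | ⟨rfl, rfl⟩
    · rfl
    · exact absurd h'.1 (h1.1 h.1)
  let Q : Finset (V × V) := P.filter fun q => σ (Sum.inl q.1) = Sum.inl q.2
  have hPK : P.image (fun q : V × V => s(q.1, q.2)) = K := by
    ext e
    induction e with | _ u v =>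
    simp only [Finset.mem_image]
    constructor
    · rintro ⟨q, hq, h⟩
      rw [← h]; exact (Finset.mem_filter.1 hq).2.2
    · intro h
      by_cases hu : u ∈ A
      · exact ⟨(u, v), by simp [P, hu, h], rfl⟩
      · have hv : v ∈ A := by by_contra hv; exact hu ((hcross u v h).2 hv)
        exact ⟨(v, u), by simp [P, hv, Sym2.eq_swap, h], Sym2.eq_swap⟩
  refine ⟨Q.image fun q => s(q.1, q.2), ⟨?_, ?_⟩, ?_⟩
  · rw [← hPK]
    exact_mod_cast Finset.image_subset_image (Finset.filter_subset _ _)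
  · intro e he f hf v hve hvf
    simp only [Finset.mem_image] at he hf
    obtain ⟨⟨u, u'⟩, hq, rfl⟩ := he
    obtain ⟨⟨z, z'⟩, hq', rfl⟩ := hf
    simp only [Q, P, Finset.mem_filter, Finset.mem_univ, true_and] at hq hq'
    have h1 := hcross _ _ hq.1.2
    have h2 := hcross _ _ hq'.1.2
    simp only [Sym2.mem_iff] at hve hvf
    rcases hve with rfl | rfl <;> rcases hvf with rfl | rfl
    · have := hq.2.symm.trans hq'.2
      simp only [Sum.inl.injEq] at this
      rw [this]
    · tauto
    · tauto
    · have := hq.2.trans hq'.2.symm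
      simp only [EmbeddingLike.apply_eq_iff_eq, Sum.inl.injEq] at this
      rw [this]
  · rw [weight, Finset.sum_image (hinj.mono (Finset.coe_subset.2 (Finset.filter_subset _ _))),
      ← hPK, Finset.sum_image hinj]
    refine (Eq.trans_le ?_ hσ).trans_eq ?_
    · rw [← Fintype.sum_prod_type', Finset.sum_filter]
      refine Finset.sum_congr rfl fun q _ => ?_
      simp only [a, W]
      split_ifs <;> simp
    · simp only [P]
      rw [← Fintype.sum_prod_type', Finset.filter_filter, Finset.sum_filter]
      refine Finset.sum_congr rfl fun q _ => ?_
      simp only [W]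
      split_ifs <;> simp_all

/-! ### Cylinder probabilities and a conditional Chebyshev inequality -/

/-- The probability that a Bernoulli random set contains `s` and avoids `t`. -/
lemma setBernoulli_real_cylinder {ι : Type*} [Finite ι] (u : Set ι) (p : unitInterval)
    (s t : Finset ι) (hst : Disjoint s t) (hs : (s : Set ι) ⊆ u) (ht : (t : Set ι) ⊆ u) :
    (setBernoulli u p).real {F | (∀ i ∈ s, i ∈ F) ∧ ∀ i ∈ t, i ∉ F} =
      (p : ℝ) ^ s.card * (1 - p) ^ t.card := by
  have hpre : ((fun q : ι → Prop => {i | q i}) ⁻¹' {F | (∀ i ∈ s, i ∈ F) ∧ ∀ i ∈ t, i ∉ F}) =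
      Set.pi ((s ∪ t : Finset ι) : Set ι) fun i => if i ∈ s then {True} else {False} := by
    ext q
    simp only [Set.mem_preimage, Set.mem_ofPred_eq, Set.mem_pi, Finset.coe_union, Set.mem_union,
      Finset.mem_coe]
    constructor
    · rintro ⟨h1, h2⟩ i (hi | hi)
      · simp [hi, h1 i hi]
      · simp [Finset.disjoint_right.1 hst hi, h2 i hi]
    · intro h
      refine ⟨fun i hi => ?_, fun i hi => ?_⟩
      · simpa [hi] using h i (Or.inl hi)
      · simpa [Finset.disjoint_right.1 hst hi] using h i (Or.inr hi)
  rw [measureReal_def, setBernoulli_apply', hpre, Measure.infinitePi_pi _ (by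
    intro i _; exact MeasurableSet.of_discrete), Finset.prod_union hst, ENNReal.toReal_mul]
  congr 1
  · rw [Finset.prod_congr rfl (g := fun _ => (unitInterval.toNNReal p : ENNReal))]
    · simp
    · intro i hi
      simp [hi, hs hi, Set.indicator]
  · rw [Finset.prod_congr rfl (g := fun _ => (unitInterval.toNNReal (unitInterval.symm p) : ENNReal))]
    · simp
    · intro i hi
      simp [Finset.disjoint_right.1 hst hi, ht hi, Set.indicator]

/-- A conditional Chebyshev bound: if the events `B i` are independent of probability `q`, then
the weighted count of those that occur rarely exceeds its mean, even given `B i₀`. -/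
lemma measureReal_inter_lt_sum_le {Ω ι : Type*} [MeasurableSpace Ω] [Finite Ω]
    [MeasurableSingletonClass Ω] (P : Measure Ω) [IsProbabilityMeasure P] (s : Finset ι)
    (B : ι → Set Ω) (q : ℝ) (hq0 : 0 < q)
    (hB : ∀ T ⊆ s, P.real {ω | ∀ i ∈ T, ω ∈ B i} = q ^ T.card)
    (g : ι → ℝ) (θ δ : ℝ) (hδ : 0 < δ) (hg0 : ∀ i, 0 ≤ g i) (hgθ : ∀ i, g i ≤ θ)
    (hg1 : ∑ i ∈ s, g i ≤ 1) (hθ : θ ≤ q * δ / 2) (i₀ : ι) (hi₀ : i₀ ∈ s) :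
    P.real {ω | ω ∈ B i₀ ∧ q * (1 + δ) < ∑ i ∈ s, g i * (B i).indicator 1 ω} ≤
      4 * θ / δ ^ 2 := by
  have hint (f : Ω → ℝ) : Integrable f P := Integrable.of_finite
  have hprod (T : Finset ι) (hT : T ⊆ s) :
      ∫ ω, ∏ i ∈ T, (B i).indicator (1 : Ω → ℝ) ω ∂P = q ^ T.card := by
    rw [← hB T hT, ← integral_indicator_one (Set.toFinite _).measurableSet]
    congr 1 with ω
    by_cases h : ∀ i ∈ T, ω ∈ B i
    · rw [Set.indicator_of_mem (by exact h), Finset.prod_eq_one]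
      · rfl
      · intro i hi; simp [h i hi]
    · rw [Set.indicator_of_notMem (by exact h)]
      push Not at h
      obtain ⟨i, hi, hω⟩ := h
      exact Finset.prod_eq_zero hi (by simp [hω])
  let X : ι → Ω → ℝ := fun i => (B i).indicator 1
  have hXX (i : ι) (ω : Ω) : X i ω * X i ω = X i ω := by
    by_cases h : ω ∈ B i <;> simp [X, h]
  have h1 {i} (hi : i ∈ s) : ∫ ω, X i ω ∂P = q := by
    simpa using hprod {i} (by simpa)
  have h2 {i j} (hi : i ∈ s) (hj : j ∈ s) (hij : i ≠ j) : ∫ ω, X i ω * X j ω ∂P = q ^ 2 := by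
    have := hprod {i, j} (by simp [Finset.insert_subset_iff, hi, hj])
    rw [Finset.card_pair hij] at this
    simpa [Finset.prod_pair hij] using this
  have h3 {i j k} (hi : i ∈ s) (hj : j ∈ s) (hk : k ∈ s) (hij : i ≠ j) (hik : i ≠ k)
      (hjk : j ≠ k) : ∫ ω, X i ω * (X j ω * X k ω) ∂P = q ^ 3 := by
    have := hprod {i, j, k} (by simp [Finset.insert_subset_iff, hi, hj, hk])
    have hn : i ∉ ({j, k} : Finset ι) := by simp [hij, hik]
    rw [Finset.card_insert_of_notMem hn, Finset.card_pair hjk] at this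
    simpa [Finset.prod_insert hn, Finset.prod_pair hjk] using this
  let s' := s.erase i₀
  let Z : Ω → ℝ := fun ω => ∑ i ∈ s', g i * (X i ω - q)
  -- With `i₀` removed, the other events are still uncorrelated given `B i₀`, so only the diagonal
  -- contributes to the conditional second moment.
  have hcov : ∀ i ∈ s', ∀ j ∈ s', ∫ ω, X i₀ ω * ((X i ω - q) * (X j ω - q)) ∂P =
      if i = j then q ^ 2 * (1 - q) else 0 := by
    intro i hi j hj
    obtain ⟨hi0, his⟩ := Finset.mem_erase.1 hi
    obtain ⟨hj0, hjs⟩ := Finset.mem_erase.1 hj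
    have e : ∀ ω, X i₀ ω * ((X i ω - q) * (X j ω - q)) = X i₀ ω * (X i ω * X j ω) -
        q * (X i₀ ω * X i ω) - q * (X i₀ ω * X j ω) + q ^ 2 * X i₀ ω := fun ω => by ring
    simp_rw [e]
    rw [integral_add (hint _) (hint _), integral_sub (hint _) (hint _),
      integral_sub (hint _) (hint _)]
    simp_rw [integral_const_mul]
    rw [h1 hi₀, h2 hi₀ his hi0.symm, h2 hi₀ hjs hj0.symm]
    split_ifs with hij
    · subst hij
      simp_rw [hXX]
      rw [h2 hi₀ his hi0.symm]; ring
    · rw [h3 hi₀ his hjs hi0.symm hj0.symm hij]; ring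
  have hsum' : g i₀ + ∑ i ∈ s', g i ≤ 1 := by
    rwa [Finset.add_sum_erase _ _ hi₀]
  have hZ : ∫ ω, X i₀ ω * Z ω ^ 2 ∂P ≤ q ^ 2 * θ := by
    have e : ∀ ω, X i₀ ω * Z ω ^ 2 = ∑ i ∈ s', ∑ j ∈ s',
        g i * g j * (X i₀ ω * ((X i ω - q) * (X j ω - q))) := fun ω => by
      simp only [Z]
      rw [sq, Finset.sum_mul_sum, Finset.mul_sum]
      refine Finset.sum_congr rfl fun i _ => ?_
      rw [Finset.mul_sum]
      exact Finset.sum_congr rfl fun j _ => by ring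
    simp_rw [e]
    rw [integral_finsetSum _ fun _ _ => hint _]
    simp_rw [integral_finsetSum _ fun _ _ => hint _, integral_const_mul]
    calc ∑ i ∈ s', ∑ j ∈ s', g i * g j * ∫ ω, X i₀ ω * ((X i ω - q) * (X j ω - q)) ∂P
        = ∑ i ∈ s', g i * g i * (q ^ 2 * (1 - q)) := by
          refine Finset.sum_congr rfl fun i hi => ?_
          rw [Finset.sum_congr rfl fun j hj => by rw [hcov i hi j hj]]
          simp [hi]
      _ ≤ ∑ i ∈ s', θ * g i * q ^ 2 := by
          refine Finset.sum_le_sum fun i _ => ?_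
          have := mul_le_mul_of_nonneg_right (hgθ i) (hg0 i)
          have h0 := mul_nonneg (hg0 i) (hg0 i)
          have hq : q ^ 2 * (1 - q) ≤ q ^ 2 := by nlinarith [sq_nonneg q]
          have hq' : 0 ≤ q ^ 2 := sq_nonneg q
          calc g i * g i * (q ^ 2 * (1 - q)) ≤ g i * g i * q ^ 2 := by gcongr
            _ ≤ θ * g i * q ^ 2 := by gcongr
      _ = q ^ 2 * θ * ∑ i ∈ s', g i := by
          rw [Finset.mul_sum]; exact Finset.sum_congr rfl fun i _ => by ring
      _ ≤ q ^ 2 * θ * 1 := by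
          have := (hg0 i₀).trans (hgθ i₀)
          have := hg0 i₀
          gcongr; linarith
      _ = q ^ 2 * θ := mul_one _
  set Bad : Set Ω := {ω | ω ∈ B i₀ ∧ q * (1 + δ) < ∑ i ∈ s, g i * (B i).indicator 1 ω}
  have hpt : ∀ ω, Bad.indicator (1 : Ω → ℝ) ω ≤ 4 / (q ^ 2 * δ ^ 2) * (X i₀ ω * Z ω ^ 2) := by
    intro ω
    by_cases hω : ω ∈ Bad
    · obtain ⟨hω0, hω1⟩ := id hω
      have hX : X i₀ ω = 1 := by simp [X, hω0]
      -- The excess is more than `q * δ`; the term of `i₀` itself accounts for at most `θ ≤ q * δ /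
      -- 2` of it.
      have hZ' : q * δ / 2 ≤ Z ω := by
        have : Z ω = (∑ i ∈ s, g i * X i ω) - g i₀ * X i₀ ω - q * ∑ i ∈ s', g i := by
          rw [← Finset.add_sum_erase _ _ hi₀, Finset.mul_sum, add_sub_cancel_left,
            ← Finset.sum_sub_distrib]
          exact Finset.sum_congr rfl fun i _ => by ring
        rw [this, hX]
        have h4 : q * ∑ i ∈ s', g i ≤ q * 1 :=
          mul_le_mul_of_nonneg_left (by linarith [hg0 i₀]) hq0.le
        have := hgθ i₀
        change q * (1 + δ) < ∑ i ∈ s, g i * X i ω at hω1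
        linarith
      rw [Set.indicator_of_mem hω, hX, one_mul, Pi.one_apply, div_mul_eq_mul_div,
        le_div_iff₀ (by positivity)]
      nlinarith [mul_pos hq0 hδ]
    · rw [Set.indicator_of_notMem hω]
      have : 0 ≤ X i₀ ω := Set.indicator_nonneg (by simp) _
      positivity
  calc P.real Bad = ∫ ω, Bad.indicator (1 : Ω → ℝ) ω ∂P :=
        (integral_indicator_one (Set.toFinite _).measurableSet).symm
    _ ≤ ∫ ω, 4 / (q ^ 2 * δ ^ 2) * (X i₀ ω * Z ω ^ 2) ∂P := integral_mono (hint _) (hint _) hpt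
    _ ≤ 4 / (q ^ 2 * δ ^ 2) * (q ^ 2 * θ) := by
        rw [integral_const_mul]; gcongr
    _ = 4 * θ / δ ^ 2 := by field_simp

/-! ### Rounding a small fractional matching through a random cut -/

instance {V : Type*} (G : SimpleGraph V) (p : unitInterval) :
    IsProbabilityMeasure (realizationLaw G p) := by
  unfold realizationLaw; infer_instance

/-- The law of a uniformly random subset of `V`. -/
noncomputable def uniformSide (V : Type*) : Measure (Set V) :=
  setBernoulli Set.univ ⟨1 / 2, by norm_num, by norm_num⟩

instance (V : Type*) : IsProbabilityMeasure (uniformSide V) := by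
  unfold uniformSide; infer_instance

/-- The event that the edge `s(u, v)` is realized and crosses the random cut. -/
def crossingEvent {V : Type*} (u v : V) : Set (Set (Sym2 V) × Set V) :=
  {ω | s(u, v) ∈ ω.1 ∧ (u ∈ ω.2 ↔ v ∉ ω.2)}

lemma crossingEvent_comm {V : Type*} (u v : V) : crossingEvent u v = crossingEvent v u := by
  ext ω
  simp only [crossingEvent, Set.mem_ofPred_eq, Sym2.eq_swap (a := u)]
  tauto

/-- Either side of `u` forces the sides of all of `W`, which gives two disjoint cylinders of measure
`(1/2) ^ (|W| + 1)`. -/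
lemma uniformSide_real_separated {V : Type*} [Finite V] (u : V) (W : Finset V) (hu : u ∉ W) :
    (uniformSide V).real {A | ∀ v ∈ W, (u ∈ A ↔ v ∉ A)} = (1 / 2 : ℝ) ^ W.card := by
  have h1 := setBernoulli_real_cylinder (Set.univ : Set V) ⟨1 / 2, by norm_num, by norm_num⟩
    {u} W (by simpa) (Set.subset_univ _) (Set.subset_univ _)
  have h2 := setBernoulli_real_cylinder (Set.univ : Set V) ⟨1 / 2, by norm_num, by norm_num⟩
    W {u} (by simpa) (Set.subset_univ _) (Set.subset_univ _)
  have hset : {A : Set V | ∀ v ∈ W, (u ∈ A ↔ v ∉ A)} =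
      {A | (∀ i ∈ ({u} : Finset V), i ∈ A) ∧ ∀ i ∈ W, i ∉ A} ∪
      {A | (∀ i ∈ W, i ∈ A) ∧ ∀ i ∈ ({u} : Finset V), i ∉ A} := by
    ext A
    by_cases h : u ∈ A <;> simp [h]
  rw [hset, measureReal_union _ (Set.toFinite _).measurableSet]
  · rw [uniformSide, h1, h2]
    simp only [Finset.card_singleton]
    ring
  · rw [Set.disjoint_left]
    rintro A ⟨h, -⟩ ⟨-, h'⟩
    exact h' u (by simp) (h u (by simp))

/-- The crossing events of the edges at a common vertex are mutually independent: relative to the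
side of `u`, the sides of its neighbours are fair independent coins. -/
lemma prod_real_crossingEvent {V : Type*} [Finite V] (G : SimpleGraph V) (p : unitInterval)
    (u : V) (W : Finset V) (hW : ∀ v ∈ W, s(u, v) ∈ G.edgeSet) :
    ((realizationLaw G p).prod (uniformSide V)).real {ω | ∀ v ∈ W, ω ∈ crossingEvent u v} =
      (p / 2 : ℝ) ^ W.card := by
  have hu : u ∉ W := fun h => G.loopless.irrefl u (hW u h)
  have hset : {ω : Set (Sym2 V) × Set V | ∀ v ∈ W, ω ∈ crossingEvent u v} =
      {F | (∀ e ∈ W.image fun v => s(u, v), e ∈ F) ∧ ∀ e ∈ (∅ : Finset (Sym2 V)), e ∉ F} ×ˢ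
        {A | ∀ v ∈ W, (u ∈ A ↔ v ∉ A)} := by
    ext ⟨F, A⟩
    simp only [crossingEvent, Set.mem_ofPred_eq, Set.mem_prod, Finset.forall_mem_image]
    constructor
    · exact fun h => ⟨⟨fun v hv => (h v hv).1, by simp⟩, fun v hv => (h v hv).2⟩
    · exact fun h v hv => ⟨h.1.1 hv, h.2 v hv⟩
  rw [hset, measureReal_prod_prod, uniformSide_real_separated u W hu, realizationLaw,
    setBernoulli_real_cylinder _ _ _ _ (by simp) _ (by simp)]
  · rw [Finset.card_image_of_injective _ fun a b h => Sym2.congr_right.1 h]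
    simp [mul_pow, div_eq_mul_inv]
  · intro e he
    simp only [Finset.coe_image, Set.mem_image] at he
    obtain ⟨v, hv, rfl⟩ := he
    exact hW v hv

/-- A fractional matching with small values on the edges of `S` is nearly attained, in
expectation, by the realized matchings in `S`. -/
lemma sum_le_integral_of_fractional {V : Type*} [Fintype V] (G : SimpleGraph V) (w : Sym2 V → ℝ)
    (hw : ∀ e ∈ G.edgeSet, 0 ≤ w e) (p : unitInterval) (hp : 0 < (p : ℝ)) (θ δ : ℝ) (hδ : 0 < δ)
    (hθ : θ ≤ p / 2 * δ / 2) (S : Set (Sym2 V)) (hS : S ⊆ G.edgeSet) (g : Sym2 V → ℝ)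
    (hg0 : ∀ e, 0 ≤ g e) (hgθ : ∀ e, g e ≤ θ) (hgS : ∀ e, g e ≠ 0 → e ∈ S)
    (hg1 : ∀ u, ∑ v, g s(u, v) ≤ 1) (m : Set (Sym2 V) → ℝ)
    (hm : ∀ F M, IsMatchingIn (S ∩ F) M → weight w M ≤ m F) :
    (1 - 16 * θ / (p * δ ^ 2)) / (1 + δ) * ∑ e, g e * w e ≤ ∫ F, m F ∂(realizationLaw G p) := by
  let P := (realizationLaw G p).prod (uniformSide V)
  have hint (f : Set (Sym2 V) × Set V → ℝ) : Integrable f P := Integrable.of_finite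
  let N : V → Finset V := fun u => Finset.univ.filter fun v => s(u, v) ∈ G.edgeSet
  let load : V → Set (Sym2 V) × Set V → ℝ := fun u ω =>
    ∑ v ∈ N u, g s(u, v) * (crossingEvent u v).indicator 1 ω
  let T : ℝ := p / 2 * (1 + δ)
  have hT : 0 < T := by positivity
  -- Quantifying over both orientations of `e` tests the loads of both endpoints. On `K` the values
  -- `g / T` then form a bipartite fractional matching.
  let K : Set (Sym2 V) × Set V → Finset (Sym2 V) := fun ω => Finset.univ.filter fun e =>
    e ∈ S ∧ ∀ u v, s(u, v) = e → ω ∈ crossingEvent u v ∧ load u ω ≤ T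
  have hpoint : ∀ ω, ∑ e, (g e / T * w e) * {ω | e ∈ K ω}.indicator 1 ω ≤ m ω.1 := by
    intro ω
    obtain ⟨M, hM, hMw⟩ := exists_matching_of_bipartite (K ω) ω.2 (fun e => g e / T) w
      (fun e => div_nonneg (hg0 e) hT.le)
      (fun u v h => ((Finset.mem_filter.1 h).2.2 u v rfl).1.2) (fun u => by
        by_cases hu : ∃ v, s(u, v) ∈ K ω
        · obtain ⟨v₀, hv₀⟩ := hu
          have hl := ((Finset.mem_filter.1 hv₀).2.2 u v₀ rfl).2
          refine le_trans ?_ ((div_le_one hT).2 hl)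
          simp only [load, N]
          rw [Finset.sum_filter, Finset.sum_div]
          refine Finset.sum_le_sum fun v _ => ?_
          have h0 := div_nonneg (hg0 s(u, v)) hT.le
          split_ifs with h1 h2 h2
          · rw [Set.indicator_of_mem ((Finset.mem_filter.1 h1).2.2 u v rfl).1]
            simp
          · exact absurd (hS (Finset.mem_filter.1 h1).2.1) h2
          · refine div_nonneg (mul_nonneg (hg0 _) (Set.indicator_nonneg (by simp) _)) hT.le
          · simp
        · push Not at hu
          simp [hu])
    refine le_trans ?_ (hMw.trans (hm ω.1 M ⟨fun e he => ?_, hM.2⟩))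
    · rw [← Finset.sum_filter_add_sum_filter_not Finset.univ (fun e => e ∈ K ω)]
      rw [Finset.sum_eq_zero (s := Finset.univ.filter fun e => e ∉ K ω), add_zero,
        Finset.filter_univ_mem]
      · exact (Finset.sum_congr rfl fun e he => by
          rw [Set.indicator_of_mem (by exact he)]; simp).le
      · intro e he
        rw [Set.indicator_of_notMem (by simpa using he), mul_zero]
    · have heK := Finset.mem_filter.1 (hM.1 he)
      refine ⟨heK.2.1, ?_⟩
      induction e with | _ u v =>
      exact (heK.2.2 u v rfl).1.1
  -- An edge crosses with probability `p / 2`, and each endpoint is simultaneously overloaded with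
  -- probability at most `4 * θ / δ ^ 2`.
  have hprob : ∀ e ∈ S, p / 2 - 8 * θ / δ ^ 2 ≤ P.real {ω | e ∈ K ω} := by
    intro e he
    induction e with | _ u v =>
    have hE : s(u, v) ∈ G.edgeSet := hS he
    have hcheb (a b : V) (hab : s(a, b) ∈ G.edgeSet) :
        P.real {ω | ω ∈ crossingEvent a b ∧ p / 2 * (1 + δ) < load a ω} ≤ 4 * θ / δ ^ 2 :=
      measureReal_inter_lt_sum_le P (N a) (crossingEvent a) (p / 2) (by positivity)
        (fun W hW => prod_real_crossingEvent G p a W fun v hv =>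
          (Finset.mem_filter.1 (hW hv)).2) (fun v => g s(a, v)) θ δ hδ (fun _ => hg0 _)
        (fun _ => hgθ _) ((Finset.sum_le_univ_sum_of_nonneg fun _ => hg0 _).trans (hg1 a)) hθ b
        (by simpa [N] using hab)
    have hB : P.real (crossingEvent u v) = p / 2 := by
      simpa using prod_real_crossingEvent G p u {v} (by simpa using hE)
    have hsub : crossingEvent u v ⊆ {ω | s(u, v) ∈ K ω} ∪
        ({ω | ω ∈ crossingEvent u v ∧ p / 2 * (1 + δ) < load u ω} ∪
          {ω | ω ∈ crossingEvent v u ∧ p / 2 * (1 + δ) < load v ω}) := by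
      intro ω hω
      have hω' := hω
      rw [crossingEvent_comm] at hω'
      by_cases h1 : T < load u ω
      · exact Or.inr (Or.inl ⟨hω, h1⟩)
      by_cases h2 : T < load v ω
      · exact Or.inr (Or.inr ⟨hω', h2⟩)
      refine Or.inl (Finset.mem_filter.2 ⟨Finset.mem_univ _, he, fun a b hab => ?_⟩)
      rcases Sym2.eq_iff.1 hab with ⟨rfl, rfl⟩ | ⟨rfl, rfl⟩
      · exact ⟨hω, not_lt.1 h1⟩
      · exact ⟨hω', not_lt.1 h2⟩
    have h1 := measureReal_mono (μ := P) hsub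
    have h2 := (h1.trans (measureReal_union_le _ _)).trans
      (add_le_add_right (measureReal_union_le _ _) _)
    have h3 := hcheb u v hE
    have h4 := hcheb v u (by rwa [Sym2.eq_swap])
    rw [hB] at h2
    have : 8 * θ / δ ^ 2 = 4 * θ / δ ^ 2 + 4 * θ / δ ^ 2 := by ring
    linarith
  calc (1 - 16 * θ / (p * δ ^ 2)) / (1 + δ) * ∑ e, g e * w e
      = ∑ e, (g e / T * w e) * (p / 2 - 8 * θ / δ ^ 2) := by
        rw [Finset.mul_sum]
        refine Finset.sum_congr rfl fun e _ => ?_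
        simp only [T]
        field_simp
        ring
    _ ≤ ∑ e, (g e / T * w e) * P.real {ω | e ∈ K ω} := by
        refine Finset.sum_le_sum fun e _ => ?_
        by_cases hge : g e = 0
        · simp [hge]
        · have heS := hgS e hge
          exact mul_le_mul_of_nonneg_left (hprob e heS)
            (mul_nonneg (div_nonneg (hg0 e) hT.le) (hw e (hS heS)))
    _ = ∫ ω, ∑ e, (g e / T * w e) * {ω | e ∈ K ω}.indicator 1 ω ∂P := by
        rw [integral_finsetSum _ fun _ _ => hint _]
        refine Finset.sum_congr rfl fun e _ => ?_
        rw [integral_const_mul, integral_indicator_one (Set.toFinite _).measurableSet]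
    _ ≤ ∫ ω, m ω.1 ∂P := integral_mono (hint _) (hint _) hpoint
    _ = ∫ F, m F ∂(realizationLaw G p) := by
        rw [integral_fun_fst]; simp

/-! ### Empirical frequencies over independent rounds -/

section Rounds

variable {Ω : Type*} {R : ℕ}

/-- The number of rounds in which the event `I` occurs. -/
noncomputable def hits (I : Set Ω) (x : Fin R → Ω) : ℝ := ∑ r, I.indicator 1 (x r)

lemma hits_nonneg (I : Set Ω) (x : Fin R → Ω) : 0 ≤ hits I x :=
  Finset.sum_nonneg fun _ _ => Set.indicator_nonneg (by simp) _

/-- The frequency of an event over the rounds, truncated to `0` when it exceeds `θ`. -/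
noncomputable def truncatedFreq (θ : ℝ) (I : Set Ω) (x : Fin R → Ω) : ℝ :=
  if hits I x / R ≤ θ then hits I x / R else 0

lemma truncatedFreq_nonneg (θ : ℝ) (I : Set Ω) (x : Fin R → Ω) : 0 ≤ truncatedFreq θ I x := by
  unfold truncatedFreq
  have := div_nonneg (hits_nonneg I x) (Nat.cast_nonneg (α := ℝ) R)
  split_ifs
  · exact this
  · exact le_rfl

lemma truncatedFreq_le (θ : ℝ) (hθ : 0 ≤ θ) (I : Set Ω) (x : Fin R → Ω) :
    truncatedFreq θ I x ≤ θ := by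
  unfold truncatedFreq
  split_ifs with h
  · exact h
  · exact hθ

lemma truncatedFreq_le_hits (θ : ℝ) (I : Set Ω) (x : Fin R → Ω) :
    truncatedFreq θ I x ≤ hits I x / R := by
  unfold truncatedFreq
  split_ifs with h
  · exact le_rfl
  · exact div_nonneg (hits_nonneg I x) (Nat.cast_nonneg (α := ℝ) R)

variable [MeasurableSpace Ω] (μ : Measure Ω) [IsProbabilityMeasure μ]

lemma pi_real_forall_mem (I : Set Ω) (T : Finset (Fin R)) :
    (Measure.pi fun _ : Fin R => μ).real {x | ∀ r ∈ T, x r ∈ I} = μ.real I ^ T.card := by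
  have : {x : Fin R → Ω | ∀ r ∈ T, x r ∈ I} =
      Set.pi Set.univ fun r => if r ∈ T then I else Set.univ := by
    ext x
    simp only [Set.mem_ofPred_eq, Set.mem_pi, Set.mem_univ, true_imp_iff]
    refine forall_congr' fun r => ?_
    split_ifs with h <;> simp [h]
  rw [this, measureReal_def, Measure.pi_pi, ENNReal.toReal_prod, ← Finset.prod_const,
    ← Finset.prod_subset (Finset.subset_univ T)]
  · exact Finset.prod_congr rfl fun r hr => by simp [hr, measureReal_def]
  · intro r _ hr
    simp [hr]

variable [Finite Ω] [MeasurableSingletonClass Ω]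

lemma integral_hits (I : Set Ω) :
    ∫ x, hits I x ∂(Measure.pi fun _ : Fin R => μ) = R * μ.real I := by
  unfold hits
  rw [integral_finsetSum _ fun _ _ => Integrable.of_finite]
  have (r : Fin R) : ∫ x, I.indicator (1 : Ω → ℝ) (x r) ∂(Measure.pi fun _ : Fin R => μ) =
      μ.real I := by
    have h := pi_real_forall_mem μ I {r}
    rw [← integral_indicator_one (Set.toFinite _).measurableSet] at h
    simpa [Set.indicator_apply] using h
  simp [this]

lemma integral_hits_sq_le (I : Set Ω) :
    ∫ x, hits I x ^ 2 ∂(Measure.pi fun _ : Fin R => μ) ≤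
      R * μ.real I + (R * μ.real I) ^ 2 := by
  have hq := measureReal_nonneg (μ := μ) (s := I)
  have hpair (r s : Fin R) : ∫ x, I.indicator (1 : Ω → ℝ) (x r) * I.indicator 1 (x s)
      ∂(Measure.pi fun _ : Fin R => μ) ≤ (if r = s then μ.real I else 0) + μ.real I ^ 2 := by
    have h := pi_real_forall_mem μ I {r, s}
    rw [← integral_indicator_one (Set.toFinite _).measurableSet] at h
    have e : ∀ x : Fin R → Ω, I.indicator (1 : Ω → ℝ) (x r) * I.indicator 1 (x s) =
        {x : Fin R → Ω | ∀ t ∈ ({r, s} : Finset (Fin R)), x t ∈ I}.indicator 1 x := fun x => by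
      by_cases h1 : x r ∈ I <;> by_cases h2 : x s ∈ I <;> simp [h1, h2]
    simp_rw [e]
    rw [h]
    split_ifs with hrs
    · subst hrs
      simp
    · rw [Finset.card_pair hrs]; simp
  have e : ∀ x : Fin R → Ω, hits I x ^ 2 =
      ∑ r, ∑ s, I.indicator (1 : Ω → ℝ) (x r) * I.indicator 1 (x s) := fun x => by
    rw [hits, sq, Finset.sum_mul_sum]
  simp_rw [e]
  rw [integral_finsetSum _ fun _ _ => Integrable.of_finite]
  simp_rw [integral_finsetSum _ fun _ _ => Integrable.of_finite]
  refine (Finset.sum_le_sum fun r _ => Finset.sum_le_sum fun s _ => hpair r s).trans_eq ?_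
  simp [Finset.sum_add_distrib]
  ring

lemma le_integral_truncatedFreq (hR : 0 < R) (θ : ℝ) (hθ : 0 < θ) (I : Set Ω) :
    μ.real I * (1 - (μ.real I / θ + 1 / (θ * R))) ≤
      ∫ x, truncatedFreq θ I x ∂(Measure.pi fun _ : Fin R => μ) := by
  have hR' : (0 : ℝ) < R := by exact_mod_cast hR
  -- Pointwise, `y - y² / θ` is at most `y` when `y ≤ θ` and at most `0` beyond, so first and second
  -- moments suffice.
  have hpt (x : Fin R → Ω) : hits I x / R - hits I x ^ 2 / (θ * R ^ 2) ≤ truncatedFreq θ I x := by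
    have h0 := div_nonneg (hits_nonneg I x) hR'.le
    have e : hits I x ^ 2 / (θ * R ^ 2) = (hits I x / R) ^ 2 / θ := by field_simp
    rw [e]
    unfold truncatedFreq
    split_ifs with h
    · have : 0 ≤ (hits I x / R) ^ 2 / θ := by positivity
      linarith
    · rw [sub_nonpos, le_div_iff₀ hθ]
      nlinarith
  have hmono := integral_mono (μ := Measure.pi fun _ : Fin R => μ) Integrable.of_finite
    Integrable.of_finite hpt
  refine le_trans ?_ hmono
  rw [integral_sub Integrable.of_finite Integrable.of_finite, integral_div, integral_div,
    integral_hits]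
  have h2 := div_le_div_of_nonneg_right (integral_hits_sq_le μ (R := R) I)
    (by positivity : (0 : ℝ) ≤ θ * R ^ 2)
  refine le_trans (le_of_eq ?_) (sub_le_sub_left h2 _)
  field_simp
  ring

end Rounds

/-! ### Weights and degrees of matchings -/

lemma weight_eq_sum_indicator {V Ω : Type*} [Fintype V] (w : Sym2 V → ℝ)
    (M : Ω → Finset (Sym2 V)) (ω : Ω) :
    weight w (M ω) = ∑ e, w e * {ω | e ∈ M ω}.indicator 1 ω := by
  simp [weight, Set.indicator_apply]

lemma maxMatchingWeight_eq {V : Type*} {w : Sym2 V → ℝ} {F : Set (Sym2 V)} {M : Finset (Sym2 V)}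
    (h : IsMaxMatchingIn w F M) : maxMatchingWeight w F = weight w M :=
  IsGreatest.csSup_eq ⟨⟨M, h.1, rfl⟩, by rintro _ ⟨M', hM', rfl⟩; exact h.2 M' hM'⟩

lemma IsMatchingIn.sum_le_one {V : Type*} [Fintype V] {F : Set (Sym2 V)} {M : Finset (Sym2 V)}
    (h : IsMatchingIn F M) (u : V) : ∑ v, (if s(u, v) ∈ M then (1 : ℝ) else 0) ≤ 1 := by
  rw [Finset.sum_boole]
  exact_mod_cast Finset.card_le_one.2 fun a ha b hb =>
    Sym2.congr_right.1 (h.2 _ (Finset.mem_filter.1 ha).2 _ (Finset.mem_filter.1 hb).2 u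
      (Sym2.mem_mk_left _ _) (Sym2.mem_mk_left _ _))

lemma degreeIn_queried_le {V : Type*} [Finite V] {G : SimpleGraph V} {w : Sym2 V → ℝ} {R : ℕ}
    {sel : Set (Sym2 V) → Finset (Sym2 V)} (hsel : IsMatchingRule G w sel)
    (𝓔 : Fin R → Set (Sym2 V)) (h𝓔 : ∀ r, 𝓔 r ⊆ G.edgeSet) (v : V) :
    degreeIn (queried sel 𝓔) v ≤ R := by
  have : {e ∈ queried sel 𝓔 | v ∈ e} = ⋃ r : Fin R, {e | e ∈ sel (𝓔 r) ∧ v ∈ e} := by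
    ext e; simp [queried]
  rw [degreeIn, this]
  refine (Set.ncard_iUnion_le_of_fintype _).trans ?_
  refine (Finset.sum_le_card_nsmul _ _ 1 fun r _ => ?_).trans (by simp)
  refine (Set.ncard_le_one (Set.toFinite _)).2 fun a ha b hb => ?_
  exact (hsel (𝓔 r) (h𝓔 r)).1.2 a ha.1 b hb.1 v ha.2 hb.2

/-! ### The two lower bounds for the reported weight -/

section Analysis

variable {V : Type*} {G : SimpleGraph V} {w : Sym2 V → ℝ}
  {sel : Set (Sym2 V) → Finset (Sym2 V)} {R : ℕ} {p : unitInterval}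

/-- The probability that the edge `e` is selected in a random realization. -/
noncomputable def selProb (G : SimpleGraph V) (p : unitInterval)
    (sel : Set (Sym2 V) → Finset (Sym2 V)) (e : Sym2 V) : ℝ :=
  (realizationLaw G p).real {F | e ∈ sel F}

instance : IsProbabilityMeasure (roundsLaw G p R) := by
  unfold roundsLaw; infer_instance

lemma mul_selProb_nonneg (hw : ∀ e ∈ G.edgeSet, 0 ≤ w e)
    (hsel : ∀ F, IsMaxMatchingIn w (G.edgeSet ∩ F) (sel F)) (e : Sym2 V) :
    0 ≤ w e * selProb G p sel e := by
  by_cases he : e ∈ G.edgeSet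
  · exact mul_nonneg (hw e he) measureReal_nonneg
  · have : {F | e ∈ sel F} = ∅ := by
      ext F
      simpa using fun h => he ((hsel F).1.1 h).1
    simp [selProb, this]

lemma opt_eq (hsel : IsMatchingRule G w sel) :
    opt G w p = ∫ F, weight w (sel (G.edgeSet ∩ F)) ∂(realizationLaw G p) := by
  unfold opt expectedMatching
  congr 1 with F
  exact maxMatchingWeight_eq (hsel _ Set.inter_subset_left)

variable [Fintype V]

lemma integral_weight_eq :
    ∫ F, weight w (sel F) ∂(realizationLaw G p) = ∑ e, w e * selProb G p sel e := by
  simp_rw [weight_eq_sum_indicator w sel]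
  rw [integral_finsetSum _ fun _ _ => Integrable.of_finite]
  refine Finset.sum_congr rfl fun e _ => ?_
  rw [integral_const_mul, integral_indicator_one (Set.toFinite _).measurableSet, selProb]

lemma roundsLaw_real_mem_queried (e : Sym2 V) :
    (roundsLaw G p R).real {𝓔 | e ∈ queried sel 𝓔} = 1 - (1 - selProb G p sel e) ^ R := by
  have h := pi_real_forall_mem (realizationLaw G p) {F | e ∈ sel F}ᶜ (Finset.univ : Finset (Fin R))
  rw [probReal_compl_eq_one_sub (Set.toFinite _).measurableSet, Finset.card_univ,
    Fintype.card_fin] at h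
  have hc : {𝓔 : Fin R → Set (Sym2 V) | e ∈ queried sel 𝓔} =
      {𝓔 | ∀ r ∈ (Finset.univ : Finset (Fin R)), 𝓔 r ∈ {F | e ∈ sel F}ᶜ}ᶜ := by
    ext 𝓔; simp [queried]
  rw [hc, probReal_compl_eq_one_sub (Set.toFinite _).measurableSet, roundsLaw, h, selProb]

/-- The contribution of the edges that are likely to be selected in a random realization. -/
lemma sum_crucial_le (hw : ∀ e ∈ G.edgeSet, 0 ≤ w e)
    (hsel : ∀ F, IsMaxMatchingIn w (G.edgeSet ∩ F) (sel F)) (τ β : ℝ)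
    (hτ : ∀ q : ℝ, τ ≤ q → q ≤ 1 → (1 - q) ^ R ≤ β) :
    (1 - β) * ∑ e with τ ≤ selProb G p sel e, w e * selProb G p sel e ≤
      ∫ 𝓔, (∫ F, weight w (sel (queried sel 𝓔 ∩ F)) ∂(realizationLaw G p)) ∂(roundsLaw G p R) := by
  let C : Finset (Sym2 V) := Finset.univ.filter fun e => τ ≤ selProb G p sel e
  have hpt (𝓔 : Fin R → Set (Sym2 V)) (F : Set (Sym2 V)) :
      ∑ e ∈ C, w e * ({𝓔 | e ∈ queried sel 𝓔}.indicator 1 𝓔 * {F | e ∈ sel F}.indicator 1 F) ≤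
        weight w (sel (queried sel 𝓔 ∩ F)) := by
    -- Competing matching: the queried edges of `C` in the matching selected for `F` itself.
    refine le_trans (le_of_eq ?_) ((hsel (queried sel 𝓔 ∩ F)).2
      (C.filter fun e => e ∈ queried sel 𝓔 ∧ e ∈ sel F) ⟨fun e he => ?_, fun e he f hf => ?_⟩)
    · rw [weight, Finset.sum_filter (s := C)]
      refine Finset.sum_congr rfl fun e _ => ?_
      by_cases h1 : e ∈ queried sel 𝓔 <;> by_cases h2 : e ∈ sel F <;> simp [h1, h2]
    · have he' := (Finset.mem_filter.1 he).2
      exact ⟨((hsel F).1.1 he'.2).1, he'.1, ((hsel F).1.1 he'.2).2⟩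
    · exact (hsel F).1.2 e (Finset.mem_filter.1 he).2.2 f (Finset.mem_filter.1 hf).2.2
  have hmono := integral_mono (μ := roundsLaw G p R) Integrable.of_finite Integrable.of_finite
    fun 𝓔 => integral_mono (μ := realizationLaw G p) Integrable.of_finite Integrable.of_finite
      (hpt 𝓔)
  refine le_trans ?_ hmono
  simp_rw [integral_finsetSum C fun _ _ => Integrable.of_finite, integral_const_mul]
  rw [Finset.mul_sum]
  refine Finset.sum_le_sum fun e he => ?_
  simp_rw [integral_indicator_one (Set.toFinite _).measurableSet]
  rw [integral_mul_const, integral_indicator_one (Set.toFinite _).measurableSet,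
    roundsLaw_real_mem_queried]
  have h1 := hτ _ (Finset.mem_filter.1 he).2 measureReal_le_one
  have h2 := mul_selProb_nonneg (p := p) hw hsel e
  calc (1 - β) * (w e * selProb G p sel e)
      ≤ (1 - (1 - selProb G p sel e) ^ R) * (w e * selProb G p sel e) := by gcongr
    _ = _ := by rw [selProb]; ring

/-- The contribution of the edges that are unlikely to be selected in a random realization. -/
lemma sum_noncrucial_le (hw : ∀ e ∈ G.edgeSet, 0 ≤ w e)
    (hsel : ∀ F, IsMaxMatchingIn w (G.edgeSet ∩ F) (sel F)) (hp : 0 < (p : ℝ)) (hR : 0 < R)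
    (τ θ δ : ℝ) (hδ : 0 < δ) (hθ0 : 0 < θ) (hθ : θ ≤ p / 2 * δ / 2)
    (hc : 0 ≤ 1 - 16 * θ / (p * δ ^ 2)) :
    (1 - 16 * θ / (p * δ ^ 2)) / (1 + δ) * (1 - (τ / θ + 1 / (θ * R))) *
        ∑ e with ¬ τ ≤ selProb G p sel e, w e * selProb G p sel e ≤
      ∫ 𝓔, (∫ F, weight w (sel (queried sel 𝓔 ∩ F)) ∂(realizationLaw G p)) ∂(roundsLaw G p R) := by
  set c := (1 - 16 * θ / (p * δ ^ 2)) / (1 + δ)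
  have hc0 : 0 ≤ c := div_nonneg hc (by positivity)
  have hR' : (0 : ℝ) < R := by exact_mod_cast hR
  let g : (Fin R → Set (Sym2 V)) → Sym2 V → ℝ := fun 𝓔 e => truncatedFreq θ {F | e ∈ sel F} 𝓔
  have hqE (𝓔 : Fin R → Set (Sym2 V)) : queried sel 𝓔 ⊆ G.edgeSet := by
    intro e he
    obtain ⟨r, hr⟩ := Set.mem_iUnion.1 he
    exact ((hsel (𝓔 r)).1.1 hr).1
  have hgq (𝓔 : Fin R → Set (Sym2 V)) (e : Sym2 V) (he : g 𝓔 e ≠ 0) : e ∈ queried sel 𝓔 := by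
    by_contra h
    have h' : ∀ r, e ∉ sel (𝓔 r) := fun r hr => h (Set.mem_iUnion.2 ⟨r, hr⟩)
    exact he (by simp [g, truncatedFreq, hits, h'])
  have hinner (𝓔 : Fin R → Set (Sym2 V)) : c * ∑ e, g 𝓔 e * w e ≤
      ∫ F, weight w (sel (queried sel 𝓔 ∩ F)) ∂(realizationLaw G p) := by
    refine sum_le_integral_of_fractional G w hw p hp θ δ hδ hθ (queried sel 𝓔) (hqE 𝓔) (g 𝓔)
      (fun e => truncatedFreq_nonneg _ _ _) (fun e => truncatedFreq_le _ hθ0.le _ _) (hgq 𝓔)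
      (fun u => ?_) _ fun F M hM => (hsel _).2 M
        ⟨fun e he => ⟨hqE 𝓔 (hM.1 he).1, hM.1 he⟩, hM.2⟩
    -- An average of `R` matchings is a fractional matching, and truncation only lowers it.
    calc ∑ v, g 𝓔 s(u, v) ≤ ∑ v, hits {F | s(u, v) ∈ sel F} 𝓔 / R :=
          Finset.sum_le_sum fun v _ => truncatedFreq_le_hits _ _ _
      _ = (∑ r, ∑ v, if s(u, v) ∈ sel (𝓔 r) then (1 : ℝ) else 0) / R := by
          rw [← Finset.sum_div, Finset.sum_comm]
          simp [hits, Set.indicator_apply]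
      _ ≤ (∑ _r : Fin R, (1 : ℝ)) / R := by
          gcongr with r
          exact (hsel (𝓔 r)).1.sum_le_one u
      _ = 1 := by simp [hR'.ne']
  have hmono := integral_mono (μ := roundsLaw G p R) Integrable.of_finite Integrable.of_finite
    hinner
  refine le_trans ?_ hmono
  rw [integral_const_mul, integral_finsetSum _ fun _ _ => Integrable.of_finite]
  simp_rw [integral_mul_const]
  rw [mul_assoc]
  refine mul_le_mul_of_nonneg_left ?_ hc0
  have hterm0 (e : Sym2 V) : 0 ≤ (∫ 𝓔, g 𝓔 e ∂(roundsLaw G p R)) * w e := by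
    by_cases he : e ∈ G.edgeSet
    · exact mul_nonneg (integral_nonneg fun _ => truncatedFreq_nonneg _ _ _) (hw e he)
    · have : ∀ 𝓔, g 𝓔 e = 0 := fun 𝓔 => by
        by_contra h
        exact he (hqE 𝓔 (hgq 𝓔 e h))
      simp [this]
  refine le_trans ?_ (Finset.sum_le_sum_of_subset_of_nonneg (Finset.filter_subset
    (fun e => ¬ τ ≤ selProb G p sel e) Finset.univ) fun e _ _ => hterm0 e)
  rw [Finset.mul_sum]
  refine Finset.sum_le_sum fun e he => ?_
  have hlt : selProb G p sel e ≤ τ := (not_le.1 (Finset.mem_filter.1 he).2).le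
  by_cases heE : e ∈ G.edgeSet
  · have h1 := le_integral_truncatedFreq (realizationLaw G p) hR θ hθ0 {F | e ∈ sel F}
    have h2 : selProb G p sel e * (1 - (τ / θ + 1 / (θ * R))) ≤ ∫ 𝓔, g 𝓔 e ∂(roundsLaw G p R) := by
      refine le_trans (mul_le_mul_of_nonneg_left ?_ measureReal_nonneg) h1
      change _ ≤ 1 - (selProb G p sel e / θ + _)
      gcongr
    calc (1 - (τ / θ + 1 / (θ * R))) * (w e * selProb G p sel e)
        = selProb G p sel e * (1 - (τ / θ + 1 / (θ * R))) * w e := by ring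
      _ ≤ _ := mul_le_mul_of_nonneg_right h2 (hw e heE)
  · have : {F | e ∈ sel F} = ∅ := by
      ext F
      simpa using fun h => heE ((hsel F).1.1 h).1
    simpa [selProb, this] using hterm0 e

/-- The rule is only constrained on subsets of `G.edgeSet`. Intersecting with it first gives a rule
that is optimal on every input and agrees almost surely with the original one. -/
lemma expectedReported_eq (hsel : IsMatchingRule G w sel) :
    expectedReported G w p R sel = ∫ 𝓔, (∫ F, weight w (sel (G.edgeSet ∩
      (queried (fun F => sel (G.edgeSet ∩ F)) 𝓔 ∩ F))) ∂(realizationLaw G p))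
        ∂(roundsLaw G p R) := by
  unfold expectedReported
  have hae : ∀ᵐ 𝓔 ∂(roundsLaw G p R), ∀ r, 𝓔 r ⊆ G.edgeSet := by
    rw [ae_all_iff]
    intro r
    exact (measurePreserving_eval (fun _ : Fin R => realizationLaw G p) r).quasiMeasurePreserving.ae
      setBernoulli_ae_subset
  refine integral_congr_ae (hae.mono fun 𝓔 h𝓔 => ?_)
  have h1 : queried (fun F => sel (G.edgeSet ∩ F)) 𝓔 = queried sel 𝓔 := by
    simp only [queried, Set.inter_eq_right.2 (h𝓔 _)]
  have h2 : queried sel 𝓔 ⊆ G.edgeSet :=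
    Set.iUnion_subset fun r => ((hsel _ (h𝓔 r)).1.1).trans (h𝓔 r)
  simp only [h1, ← Set.inter_assoc, Set.inter_eq_right.2 h2, reported]

lemma le_expectedReported (hw : ∀ e ∈ G.edgeSet, 0 ≤ w e) (hsel : IsMatchingRule G w sel)
    (hp : 0 < (p : ℝ)) (hR : 0 < R) (ε τ θ δ : ℝ)
    (hτ : ∀ q : ℝ, τ ≤ q → q ≤ 1 → (1 - q) ^ R ≤ 2 * ε) (hδ : 0 < δ) (hθ0 : 0 < θ)
    (hθ : θ ≤ p / 2 * δ / 2) (hc : 0 ≤ 1 - 16 * θ / (p * δ ^ 2))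
    (hloss : 1 - 2 * ε ≤ (1 - 16 * θ / (p * δ ^ 2)) / (1 + δ) * (1 - (τ / θ + 1 / (θ * R)))) :
    (1 / 2 - ε) * opt G w p ≤ expectedReported G w p R sel := by
  have hsel' : ∀ F, IsMaxMatchingIn w (G.edgeSet ∩ F) (sel (G.edgeSet ∩ F)) :=
    fun F => hsel _ Set.inter_subset_left
  have h1 := sum_crucial_le (R := R) (p := p) hw hsel' τ _ hτ
  have h2 := sum_noncrucial_le (p := p) hw hsel' hp hR τ θ δ hδ hθ0 hθ hc
  have h3 := mul_le_mul_of_nonneg_right hloss (Finset.sum_nonneg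
    (s := Finset.univ.filter fun e => ¬ τ ≤ selProb G p (fun F => sel (G.edgeSet ∩ F)) e)
      fun e _ => mul_selProb_nonneg (p := p) hw hsel' e)
  rw [opt_eq hsel, integral_weight_eq (sel := fun F => sel (G.edgeSet ∩ F)),
    ← Finset.sum_filter_add_sum_filter_not Finset.univ
      (fun e => τ ≤ selProb G p (fun F => sel (G.edgeSet ∩ F)) e), expectedReported_eq hsel]
  linarith

end Analysis

/-! ### Choice of parameters -/

lemma one_le_log_one_div {x : ℝ} (hx : 0 < x) (hx1 : x ≤ Real.exp (-1)) :
    1 ≤ Real.log (1 / x) := by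
  have := Real.log_le_log hx hx1
  rw [Real.log_exp] at this
  rw [one_div, Real.log_inv]
  linarith

lemma rounds_le (ε p : ℝ) (hε : 0 < ε) (hε1 : ε ≤ Real.exp (-1)) (hp : 0 < p) (hp1 : p ≤ 1) :
    (rounds ε p : ℝ) ≤ 2001 * (1 / (ε ^ 4 * p)) * Real.log (1 / (ε ^ 4 * p)) ^ 2 := by
  have hεle : ε ≤ 1 := hε1.trans (by simp)
  have h4 : ε ^ 4 ≤ ε := pow_le_of_le_one hε.le hεle (by norm_num)
  have hεp : ε ^ 4 * p ≤ ε * p := by gcongr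
  have hεp' : ε * p ≤ ε := mul_le_of_le_one_right hε.le hp1
  have h0 : 0 < ε ^ 4 * p := by positivity
  have hL1 := one_le_log_one_div hε hε1
  have hL1L : Real.log (1 / ε) ≤ Real.log (1 / (ε ^ 4 * p)) :=
    Real.log_le_log (by positivity) (one_div_le_one_div_of_le h0 (hεp.trans hεp'))
  have hL2L : Real.log (1 / (ε * p)) ≤ Real.log (1 / (ε ^ 4 * p)) :=
    Real.log_le_log (by positivity) (one_div_le_one_div_of_le h0 hεp)
  have hL2 := one_le_log_one_div (mul_pos hε hp) (hεp'.trans hε1)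
  have hQ : 1 ≤ 1 / (ε ^ 4 * p) := (one_le_div h0).2 ((hεp.trans hεp').trans hεle)
  set L := Real.log (1 / (ε ^ 4 * p))
  set Q := 1 / (ε ^ 4 * p) with hQdef
  have hx : 2000 * Real.log (1 / ε) * Real.log (1 / (ε * p)) / (ε ^ 4 * p) ≤
      2000 * Q * L ^ 2 := by
    have : Real.log (1 / ε) * Real.log (1 / (ε * p)) ≤ L * L :=
      mul_le_mul hL1L hL2L (by linarith) (by linarith)
    calc _ = 2000 * Q * (Real.log (1 / ε) * Real.log (1 / (ε * p))) := by rw [hQdef]; ring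
      _ ≤ 2000 * Q * (L * L) := by gcongr
      _ = _ := by ring
  -- This absorbs the rounding up in `rounds`, turning `2000` into `2001`.
  have h1 : 1 ≤ Q * L ^ 2 := one_le_mul_of_one_le_of_one_le hQ (one_le_pow₀ (hL1.trans hL1L))
  have hceil := (Nat.ceil_lt_add_one (a := 2000 * Real.log (1 / ε) * Real.log (1 / (ε * p)) / (ε ^ 4 * p))
    (div_nonneg (mul_nonneg (mul_nonneg (by norm_num) (by linarith)) (by linarith)) h0.le)).le
  unfold rounds
  linarith

lemma half_sub_mul_opt_le {V : Type*} [Finite V] {G : SimpleGraph V} {w : Sym2 V → ℝ}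
    {sel : Set (Sym2 V) → Finset (Sym2 V)} {p : unitInterval}
    (hw : ∀ e ∈ G.edgeSet, 0 ≤ w e) (hsel : IsMatchingRule G w sel) (hp : 0 < (p : ℝ))
    (ε : ℝ) (hε : 0 < ε) (hε1 : ε ≤ Real.exp (-1)) :
    (1 / 2 - ε) * opt G w p ≤ expectedReported G w p (rounds ε p) sel := by
  have := Fintype.ofFinite V
  have hεle : ε ≤ 1 := hε1.trans (by simp)
  have hL1 := one_le_log_one_div hε hε1
  have hL2 := one_le_log_one_div (mul_pos hε hp)
    ((mul_le_of_le_one_right hε.le p.2.2).trans hε1)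
  have hR : 2000 * Real.log (1 / ε) * Real.log (1 / (ε * p)) / (ε ^ 4 * p) ≤ rounds ε p :=
    Nat.le_ceil _
  have hexp : Real.exp (-Real.log (1 / ε)) = ε := by
    rw [one_div, Real.log_inv, neg_neg, Real.exp_log hε]
  generalize rounds ε p = R at hR ⊢
  set L1 := Real.log (1 / ε)
  set L2 := Real.log (1 / (ε * p))
  have hL1pos : 0 < L1 := by linarith
  have hL2pos : 0 < L2 := by linarith
  have hR0 : (0 : ℝ) < R := lt_of_lt_of_le (by positivity) hR
  have hLL : 1 ≤ L1 * L2 := one_le_mul_of_one_le_of_one_le hL1 hL2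
  have h16 : 16 * (p * ε ^ 3 / 128) / (p * (ε / 2) ^ 2) = ε / 2 := by field_simp; norm_num
  -- Here `τ * R ≥ log (1/ε)`, so a likely edge is missed with probability at most `ε`. With `δ =
  -- ε/2` and `θ = p ε³ / 128`, overloading costs `ε/2`, while `τ/θ` and `1/(θR)` cost at most `ε/8`
  -- each.
  refine le_expectedReported hw hsel hp (by exact_mod_cast hR0) ε (ε ^ 4 * p / (2000 * L2))
    (p * ε ^ 3 / 128) (ε / 2) (fun q hq hq1 => ?_) (by positivity) (by positivity) ?_ ?_ ?_
  · have hqR : L1 ≤ q * R := by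
      calc L1 = ε ^ 4 * p / (2000 * L2) * (2000 * L1 * L2 / (ε ^ 4 * p)) := by field_simp
        _ ≤ q * R := mul_le_mul hq hR (by positivity) (le_trans (by positivity) hq)
    calc (1 - q) ^ R ≤ Real.exp (-q) ^ R :=
          pow_le_pow_left₀ (by linarith) (by linarith [Real.add_one_le_exp (-q)]) _
      _ = Real.exp (-(q * R)) := by rw [← Real.exp_nat_mul]; ring_nf
      _ ≤ Real.exp (-L1) := Real.exp_le_exp.2 (by linarith)
      _ = ε := hexp
      _ ≤ 2 * ε := by linarith
  · have : ε ^ 3 ≤ ε := pow_le_of_le_one hε.le hεle (by norm_num)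
    nlinarith
  · rw [h16]; linarith
  · rw [h16]
    have hκ1 : ε ^ 4 * p / (2000 * L2) / (p * ε ^ 3 / 128) ≤ ε / 8 := by
      have : ε ^ 4 * p / (2000 * L2) / (p * ε ^ 3 / 128) = 128 * ε / (2000 * L2) := by
        field_simp
      rw [this, div_le_div_iff₀ (by positivity) (by norm_num)]
      nlinarith
    have hκ2 : 1 / (p * ε ^ 3 / 128 * R) ≤ ε / 8 := by
      have h8 : 8 / ε ≤ p * ε ^ 3 / 128 * R := by
        calc 8 / ε ≤ 2000 / (128 * ε) * (L1 * L2) := by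
              rw [div_mul_eq_mul_div, div_le_div_iff₀ hε (by positivity)]
              nlinarith
          _ = p * ε ^ 3 / 128 * (2000 * L1 * L2 / (ε ^ 4 * p)) := by field_simp
          _ ≤ p * ε ^ 3 / 128 * R := by gcongr
      calc _ ≤ 1 / (8 / ε) := one_div_le_one_div_of_le (by positivity) h8
        _ = ε / 8 := by rw [one_div_div]
    have h1 : 1 - ε ≤ (1 - ε / 2) / (1 + ε / 2) := by
      rw [le_div_iff₀ (by positivity)]
      nlinarith
    calc 1 - 2 * ε ≤ (1 - ε) * (1 - ε / 4) := by nlinarith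
      _ ≤ _ := mul_le_mul h1 (by linarith) (by linarith)
        (div_nonneg (by linarith) (by positivity))

end StochasticMatching

theorem mainTheorem3 :
    ∃ ε₀ : ℝ, 0 < ε₀ ∧ ∃ (C : ℝ) (k : ℕ),
      ∀ ε : ℝ, 0 < ε → ε ≤ ε₀ →
      ∀ p : unitInterval, 0 < (p : ℝ) →
      ∀ (V : Type*) [Finite V] (G : SimpleGraph V) (w : Sym2 V → ℝ),
        (∀ e ∈ G.edgeSet, 0 ≤ w e) →
      ∀ sel : Set (Sym2 V) → Finset (Sym2 V), StochasticMatching.IsMatchingRule G w sel →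
        (∀ 𝓔 : Fin (StochasticMatching.rounds ε p) → Set (Sym2 V),
          (∀ r, 𝓔 r ⊆ G.edgeSet) → ∀ v : V,
            (StochasticMatching.degreeIn (StochasticMatching.queried sel 𝓔) v : ℝ) ≤
              C * (1 / (ε ^ 4 * p)) * Real.log (1 / (ε ^ 4 * p)) ^ k) ∧
        (1 / 2 - ε) * StochasticMatching.opt G w p ≤
          StochasticMatching.expectedReported G w p (StochasticMatching.rounds ε p) sel := by
  -- The bound `ε ≤ exp (-1)` makes every logarithm involved at least `1`.
  refine ⟨Real.exp (-1), Real.exp_pos _, 2001, 2, ?_⟩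
  intro ε hε hε1 p hp V _ G w hw sel hsel
  refine ⟨fun 𝓔 h𝓔 v => ?_, StochasticMatching.half_sub_mul_opt_le hw hsel hp ε hε hε1⟩
  exact le_trans (by exact_mod_cast StochasticMatching.degreeIn_queried_le hsel 𝓔 h𝓔 v)
    (StochasticMatching.rounds_le ε p hε hε1 hp p.2.2)
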